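/- For a probability distribution $p$ on $\mathbb{Z}_+=\{0,1,2,\dots\}$ let $G_p(s)=\sum_{k\ge 0}s^k p(k)$ be its generating function, let $\eta(p)=\min\{s\in[0,1]: G_p(s)=s\}$ be the smallest fixed point of $G_p$ in $[0,1]$ (the extinction probability of a Galton–Watson process with offspring distribution $p$), and let $\zeta(p)=1-\eta(p)$. If $p$ has mean $m_1(p)=\sum_k k\,p(k)\in(0,\infty)$, let $p^\circ$ be the downshifted size-biased distribution $p^\circ(k)=(k+1)p(k+1)/m_1(p)$, $k\ge 0$, and set \[ \zeta_{\rm CM}(p)=1-G_p(\eta(p^\circ)). \] For a probability distribution $\mu$ on $[0,\infty)$ let $\operatorname{MPoi}(\mu)$ be the mixed Poisson distribution with mass function $k\mapsto\int e^{-x}\frac{x^k}{k!}\,\mu(dx)$, let $\operatorname{Par}(\alpha,c)$ be the Pareto distribution with shape $\alpha$ and scale $c$, i.e. with density $\alpha c^\alpha t^{-\alpha-1}1(t>c)$, and let $\operatorname{Poi}(x)$ be the Poisson distribution with mean $x$. Define \[ \lambda_{\rm cr}=\inf\{x\ge 0:\ x\,\zeta(\operatorname{Poi}(x))=2\}, \]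 and, for $\lambda>0$ and $\alpha>1$, let $p_\alpha=\operatorname{MPoi}\bigl(\operatorname{Par}(\alpha,\lambda(1-1/\alpha))\bigr)$ (the scale being chosen so that the mean is $\lambda$). **Theorem.** For any $\lambda>\lambda_{\rm cr}$ there exists a constant $\alpha_{\rm cr}>1$ such that \[ \zeta_{\rm CM}(p_\alpha)\le\zeta_{\rm CM}(p_\beta)\le\zeta_{\rm CM}(\operatorname{Poi}(\lambda)) \qquad\text{for all } \alpha_{\rm cr}\le\alpha\le\beta . \] -/

import Mathlib

open MeasureTheory ProbabilityTheory
open scoped ENNReal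

namespace BranchingCM

/-- The mean `m₁(p) = ∑ k p(k)` of a distribution `p` on the nonnegative integers. -/
noncomputable def mean (p : Measure ℕ) : ℝ≥0∞ := ∑' k : ℕ, (k : ℝ≥0∞) * p {k}

/-- The size biasing `p*` of `p`: the distribution with mass function `p*(k) = k p(k) / m₁(p)`
(meaningful when `0 < m₁(p) < ∞`). -/
noncomputable def sizeBias (p : Measure ℕ) : Measure ℕ :=
  Measure.sum fun k : ℕ => ((k : ℝ≥0∞) * p {k} / mean p) • Measure.dirac k

/-- The downshifted size biasing `p°` of `p`: the distribution with mass function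
`p°(k) = p*(k + 1)`. -/
noncomputable def downshiftedSizeBias (p : Measure ℕ) : Measure ℕ :=
  Measure.sum fun k : ℕ => (sizeBias p {k + 1}) • Measure.dirac k

/-- The generating function `G_p(s) = ∑ s^k p(k)`, used for `s ∈ [0,1]`. -/
noncomputable def genFun (p : Measure ℕ) (s : ℝ) : ℝ := ∑' k : ℕ, s ^ k * p.real {k}

/-- `η(p)`: the smallest fixed point of `G_p` in `[0,1]`. -/
noncomputable def extinctionProb (p : Measure ℕ) : ℝ :=
  sInf {s : ℝ | s ∈ Set.Icc (0 : ℝ) 1 ∧ genFun p s = s}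

/-- `ζ(p) = 1 - η(p)`. -/
noncomputable def survivalProb (p : Measure ℕ) : ℝ := 1 - extinctionProb p

/-- The configuration model branching functional `ζ_CM(p) = 1 - G_p(η(p°))`. -/
noncomputable def zetaCM (p : Measure ℕ) : ℝ :=
  1 - genFun p (extinctionProb (downshiftedSizeBias p))

/-- The Poisson distribution with mean `x ≥ 0`. -/
noncomputable def poi (x : ℝ) : Measure ℕ := poissonMeasure x.toNNReal

/-- The mixed Poisson distribution `MPoi(μ)`, for a probability distribution `μ` on the
nonnegative reals: its mass at `k` is `∫ e^{-x} x^k / k! μ(dx)`. -/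
noncomputable def mixedPoi (μ : Measure ℝ) : Measure ℕ :=
  Measure.sum fun k : ℕ => (∫⁻ x, poi x {k} ∂μ) • Measure.dirac k

/-- The Pareto-mixed Poisson distribution `p_α = MPoi(Par(α, lam (1 - 1/α)))` with shape `α`
and scale `lam (1 - 1/α)` (Mathlib's `paretoMeasure` takes the scale first). -/
noncomputable def paretoMixedPoi (lam α : ℝ) : Measure ℕ :=
  mixedPoi (paretoMeasure (lam * (1 - 1 / α)) α)

/-- `λ_cr = inf {x ≥ 0 : x ζ(Poi(x)) = 2}`. -/
noncomputable def lambdaCr : ℝ := sInf {x : ℝ | 0 ≤ x ∧ x * survivalProb (poi x) = 2}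

end BranchingCM

/-!
For `c > 0` the map `x ↦ x e^{-xu}` is convex on `[c, ∞)` as soon as `2 ≤ c u`. If `μ` precedes `ν`
in the convex order and both live on `[c, ∞)`, then, writing `MPoi(μ)° = MPoi(μ*)` with `μ*` the
size biasing of `μ`, the generating functions of `MPoi(μ)` and `MPoi(μ)°` lie below those of
`MPoi(ν)` and `MPoi(ν)°` at all `s ≤ 1 - 2 / c`. This range contains the fixed point `η(MPoi(ν)°)`,
because `G(s) ≤ e^{-c(1 - s)}` for the generating function `G` of `MPoi(ν)°`, and
`e^{-2} ≤ 1 - 2 / c` exactly when `c ≥ 2 / (1 - e^{-2}) = λ_cr`. Hence `MPoi(μ)` has the larger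
`ζ_CM`. The Pareto distributions of mean `λ` are the laws of `λ(1 - 1/α) e^{T/α}`, with `T` a
standard exponential variable. As functions of `T`, two of these cross exactly once, so these laws
decrease in the convex order as `α` grows, towards the Dirac mass at `λ`.
-/

namespace BranchingCM

open Set

/-! ### Generating functions and their smallest fixed points -/

section GenFun

variable (p : Measure ℕ)

lemma genFun_nonneg {s : ℝ} (hs : 0 ≤ s) : 0 ≤ genFun p s :=
  tsum_nonneg fun k => mul_nonneg (pow_nonneg hs k) measureReal_nonneg

variable {p}

lemma extinctionProb_le {s : ℝ} (hs : s ∈ Icc (0 : ℝ) 1) (hfix : genFun p s = s) :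
    extinctionProb p ≤ s :=
  csInf_le ⟨0, fun _ ht => ht.1.1⟩ ⟨hs, hfix⟩

variable [IsFiniteMeasure p]

lemma summable_measureReal_singleton : Summable fun k : ℕ => p.real {k} :=
  summable_measure_toReal (fun k => measurableSet_singleton k)
    fun _ _ hij => disjoint_singleton.2 hij

lemma summable_pow_mul_measureReal_singleton {s : ℝ} (hs : s ∈ Icc (0 : ℝ) 1) :
    Summable fun k : ℕ => s ^ k * p.real {k} :=
  summable_measureReal_singleton.of_nonneg_of_le
    (fun k => mul_nonneg (pow_nonneg hs.1 k) measureReal_nonneg)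
    fun _ => mul_le_of_le_one_left measureReal_nonneg (pow_le_one₀ hs.1 hs.2)

lemma monotoneOn_genFun : MonotoneOn (genFun p) (Icc 0 1) := fun _ hs _ ht hst =>
  (summable_pow_mul_measureReal_singleton hs).tsum_le_tsum
    (fun k => mul_le_mul_of_nonneg_right (pow_le_pow_left₀ hs.1 hst k) measureReal_nonneg)
    (summable_pow_mul_measureReal_singleton ht)

lemma continuousOn_genFun : ContinuousOn (genFun p) (Icc 0 1) := by
  refine continuousOn_tsum (fun _ => by fun_prop) (summable_measureReal_singleton (p := p))
    fun k s hs => ?_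
  rw [Real.norm_of_nonneg (mul_nonneg (pow_nonneg hs.1 k) measureReal_nonneg)]
  exact mul_le_of_le_one_left measureReal_nonneg (pow_le_one₀ hs.1 hs.2)

lemma exists_genFun_eq_self_of_genFun_le {s : ℝ} (hs : s ∈ Icc (0 : ℝ) 1) (hle : genFun p s ≤ s) :
    ∃ t ∈ Icc 0 s, genFun p t = t := by
  have hcont : ContinuousOn (fun t => genFun p t - t) (Icc 0 s) :=
    (continuousOn_genFun.mono (Icc_subset_Icc_right hs.2)).sub continuousOn_id
  obtain ⟨t, ht, hzero⟩ := intermediate_value_Icc' hs.1 hcont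
    ⟨sub_nonpos.2 hle, sub_nonneg.2 (genFun_nonneg p le_rfl)⟩
  exact ⟨t, ht, sub_eq_zero.1 hzero⟩

lemma extinctionProb_mem_Icc_of_genFun_le {s : ℝ} (hs : s ∈ Icc (0 : ℝ) 1)
    (hle : genFun p s ≤ s) : extinctionProb p ∈ Icc 0 s := by
  obtain ⟨t, ht, hfix⟩ := exists_genFun_eq_self_of_genFun_le hs hle
  exact ⟨Real.sInf_nonneg fun _ h => h.1.1,
    (extinctionProb_le ⟨ht.1, ht.2.trans hs.2⟩ hfix).trans ht.2⟩

lemma genFun_extinctionProb_of_genFun_le {s : ℝ} (hs : s ∈ Icc (0 : ℝ) 1) (hle : genFun p s ≤ s) :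
    genFun p (extinctionProb p) = extinctionProb p := by
  obtain ⟨t, ht, hfix⟩ := exists_genFun_eq_self_of_genFun_le hs hle
  have hclosed : IsClosed {s : ℝ | s ∈ Icc (0 : ℝ) 1 ∧ genFun p s = s} :=
    isClosed_Icc.isClosed_eq continuousOn_genFun continuousOn_id
  exact (hclosed.csInf_mem ⟨t, ⟨ht.1, ht.2.trans hs.2⟩, hfix⟩ ⟨0, fun _ h => h.1.1⟩).2

end GenFun

lemma extinctionProb_eq_of_strictConvexOn {p : Measure ℕ} [IsProbabilityMeasure p]
    (hconv : StrictConvexOn ℝ (Icc 0 1) (genFun p)) {s : ℝ} (hs : s ∈ Ico (0 : ℝ) 1)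
    (hfix : genFun p s = s) : extinctionProb p = s := by
  have hs' : s ∈ Icc (0 : ℝ) 1 := Ico_subset_Icc_self hs
  have hη := extinctionProb_mem_Icc_of_genFun_le hs' hfix.le
  refine hη.2.antisymm (not_lt.1 fun hlt => ?_)
  have hslope := hconv.slope_strict_mono_adjacent ⟨hη.1, hη.2.trans hs'.2⟩
    (right_mem_Icc.2 zero_le_one) hlt hs.2
  have hone : genFun p 1 = 1 := by
    simpa [genFun] using (integral_countable (μ := p) (integrable_const (1 : ℝ))).symm
  rw [genFun_extinctionProb_of_genFun_le hs' hfix.le, hfix, hone,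
    div_self (sub_pos.2 hlt).ne', div_self (sub_pos.2 hs.2).ne'] at hslope
  exact lt_irrefl _ hslope

/-! ### Poisson distributions and the critical value -/

section Poisson

instance (x : ℝ) : IsProbabilityMeasure (poi x) :=
  inferInstanceAs (IsProbabilityMeasure (poissonMeasure x.toNNReal))

lemma tsum_poi_singleton (x : ℝ) : ∑' k : ℕ, poi x {k} = 1 := by
  simpa using (lintegral_countable' (μ := poi x) 1).symm

lemma measurable_poi_singleton (k : ℕ) : Measurable fun x : ℝ => poi x {k} := by
  simp only [poi, poissonMeasure_singleton]
  fun_prop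

lemma succ_mul_poi_succ (x : ℝ) (k : ℕ) :
    ((k + 1 : ℕ) : ℝ≥0∞) * poi x {k + 1} = ENNReal.ofReal x * poi x {k} := by
  simp only [poi, poissonMeasure_singleton]
  rw [← ENNReal.ofReal_natCast, ← ENNReal.ofReal_mul (by positivity),
    show ENNReal.ofReal x = ENNReal.ofReal x.toNNReal from (ENNReal.ofReal_coe_nnreal).symm,
    ← ENNReal.ofReal_mul (by positivity), Nat.factorial_succ]
  congr 1
  push_cast
  field_simp
  ring

lemma genFun_poi {x : ℝ} (hx : 0 ≤ x) (s : ℝ) :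
    genFun (poi x) s = Real.exp (-(x * (1 - s))) := by
  have hsum := (NormedSpace.expSeries_div_hasSum_exp (s * x)).mul_left (Real.exp (-x))
  rw [← Real.exp_eq_exp_ℝ, ← Real.exp_add, show -x + s * x = -(x * (1 - s)) by ring] at hsum
  rw [genFun, ← hsum.tsum_eq]
  refine tsum_congr fun k => ?_
  rw [poi, poissonMeasure_real_singleton, Real.coe_toNNReal x hx, mul_pow]
  ring

lemma strictConvexOn_genFun_poi {x : ℝ} (hx : 0 < x) :
    StrictConvexOn ℝ (Icc 0 1) (genFun (poi x)) := by
  refine ⟨convex_Icc 0 1, fun s _ t _ hst a b ha hb hab => ?_⟩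
  have hne : -(x * (1 - s)) ≠ -(x * (1 - t)) := by simpa [hx.ne'] using hst
  have hexp := strictConvexOn_exp.2 (mem_univ _) (mem_univ _) hne ha hb hab
  simp only [genFun_poi hx.le, smul_eq_mul] at hexp ⊢
  convert! hexp using 2
  linear_combination x * hab

lemma div_one_sub_exp_neg_pos {y : ℝ} (hy : 0 < y) : 0 < y / (1 - Real.exp (-y)) :=
  div_pos hy (sub_pos.2 (Real.exp_lt_one_iff.2 (neg_neg_of_pos hy)))

lemma extinctionProb_poi_div_one_sub_exp_neg {y : ℝ} (hy : 0 < y) :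
    extinctionProb (poi (y / (1 - Real.exp (-y)))) = Real.exp (-y) := by
  have hlt : Real.exp (-y) < 1 := Real.exp_lt_one_iff.2 (neg_neg_of_pos hy)
  have hpos := div_one_sub_exp_neg_pos hy
  refine extinctionProb_eq_of_strictConvexOn (strictConvexOn_genFun_poi hpos)
    ⟨(Real.exp_pos _).le, hlt⟩ ?_
  rw [genFun_poi hpos.le, div_mul_cancel₀ _ (sub_pos.2 hlt).ne']

lemma lambdaCr_eq : lambdaCr = 2 / (1 - Real.exp (-2)) := by
  have hpos : 0 < 1 - Real.exp (-2) := sub_pos.2 (Real.exp_lt_one_iff.2 (by norm_num))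
  suffices {x : ℝ | 0 ≤ x ∧ x * survivalProb (poi x) = 2} = {2 / (1 - Real.exp (-2))} by
    rw [lambdaCr, this, csInf_singleton]
  refine Subset.antisymm (fun x hx => ?_) (singleton_subset_iff.2 ⟨by positivity, ?_⟩)
  · have hfix := genFun_extinctionProb_of_genFun_le (p := poi x) (right_mem_Icc.2 zero_le_one)
      (by simp [genFun_poi hx.1])
    have hη : extinctionProb (poi x) = Real.exp (-2) := by
      rw [← hfix, genFun_poi hx.1, ← survivalProb, hx.2]
    rw [mem_singleton_iff, eq_div_iff hpos.ne', ← hη]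
    exact hx.2
  · rw [survivalProb, extinctionProb_poi_div_one_sub_exp_neg two_pos, div_mul_cancel₀ _ hpos.ne']

lemma lambdaCr_pos : 0 < lambdaCr :=
  lambdaCr_eq ▸ div_one_sub_exp_neg_pos two_pos

lemma exp_neg_le_one_sub_div {c y : ℝ} (hy : 0 < y) (hc : y / (1 - Real.exp (-y)) ≤ c) :
    Real.exp (-y) ≤ 1 - y / c := by
  have hexp : 0 < 1 - Real.exp (-y) := sub_pos.2 (Real.exp_lt_one_iff.2 (neg_neg_of_pos hy))
  rw [le_sub_comm, div_le_iff₀ ((div_one_sub_exp_neg_pos hy).trans_le hc), ← div_le_iff₀' hexp]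
  exact hc

end Poisson

/-! ### Mixed Poisson distributions -/

section MixedPoisson

variable (μ : Measure ℝ)

lemma mixedPoi_singleton (k : ℕ) : mixedPoi μ {k} = ∫⁻ x, poi x {k} ∂μ :=
  Measure.sum_smul_dirac_singleton

lemma mixedPoi_univ : mixedPoi μ univ = μ univ := by
  calc mixedPoi μ univ = ∑' k : ℕ, ∫⁻ x, poi x {k} ∂μ := by simp [mixedPoi]
    _ = ∫⁻ x, ∑' k : ℕ, poi x {k} ∂μ :=
      (lintegral_tsum fun k => (measurable_poi_singleton k).aemeasurable).symm
    _ = μ univ := by simp [tsum_poi_singleton]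

instance [IsFiniteMeasure μ] : IsFiniteMeasure (mixedPoi μ) :=
  ⟨by rw [mixedPoi_univ]; exact measure_lt_top μ univ⟩

lemma mixedPoi_dirac (x : ℝ) : mixedPoi (Measure.dirac x) = poi x := by
  refine Measure.ext_of_singleton fun k => ?_
  rw [mixedPoi_singleton, lintegral_dirac' _ (measurable_poi_singleton k)]

lemma succ_mul_mixedPoi_succ (k : ℕ) :
    ((k + 1 : ℕ) : ℝ≥0∞) * mixedPoi μ {k + 1} = ∫⁻ x, ENNReal.ofReal x * poi x {k} ∂μ := by
  rw [mixedPoi_singleton, ← lintegral_const_mul _ (measurable_poi_singleton _)]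
  exact lintegral_congr fun x => succ_mul_poi_succ x k

/-- The size biasing `μ*` of a distribution `μ` on the nonnegative reals, with density
`x / ∫ y μ(dy)` with respect to `μ`. As for `sizeBias`, it is meaningful when the mean of `μ` is
positive and finite; it vanishes when the mean is `0` or `∞`. -/
noncomputable def sizeBiasReal : Measure ℝ :=
  μ.withDensity fun x => ENNReal.ofReal x / ∫⁻ y, ENNReal.ofReal y ∂μ

lemma sizeBiasReal_univ_le_one : sizeBiasReal μ univ ≤ 1 := by
  rw [sizeBiasReal, withDensity_apply _ .univ, Measure.restrict_univ]
  simp only [div_eq_mul_inv]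
  rw [lintegral_mul_const _ ENNReal.measurable_ofReal, ← div_eq_mul_inv]
  exact ENNReal.div_self_le_one

instance : IsFiniteMeasure (sizeBiasReal μ) :=
  ⟨(sizeBiasReal_univ_le_one μ).trans_lt ENNReal.one_lt_top⟩

lemma mean_mixedPoi : mean (mixedPoi μ) = ∫⁻ x, ENNReal.ofReal x ∂μ := by
  calc mean (mixedPoi μ) = ∑' k : ℕ, ((k + 1 : ℕ) : ℝ≥0∞) * mixedPoi μ {k + 1} := by
        rw [mean, tsum_eq_zero_add' ENNReal.summable, Nat.cast_zero, zero_mul, zero_add]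
    _ = ∫⁻ x, ∑' k : ℕ, ENNReal.ofReal x * poi x {k} ∂μ := by
        simp_rw [succ_mul_mixedPoi_succ]
        exact (lintegral_tsum fun k => (ENNReal.measurable_ofReal.mul
          (measurable_poi_singleton k)).aemeasurable).symm
    _ = ∫⁻ x, ENNReal.ofReal x ∂μ := by
        simp [ENNReal.tsum_mul_left, tsum_poi_singleton]

lemma downshiftedSizeBias_mixedPoi :
    downshiftedSizeBias (mixedPoi μ) = mixedPoi (sizeBiasReal μ) := by
  refine Measure.ext_of_singleton fun k => ?_
  have hden : Measurable fun x : ℝ => ENNReal.ofReal x / ∫⁻ y, ENNReal.ofReal y ∂μ := by fun_prop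
  have hpoi := measurable_poi_singleton k
  calc downshiftedSizeBias (mixedPoi μ) {k}
      = (∫⁻ x, ENNReal.ofReal x * poi x {k} ∂μ) / ∫⁻ x, ENNReal.ofReal x ∂μ := by
        rw [downshiftedSizeBias, Measure.sum_smul_dirac_singleton, sizeBias,
          Measure.sum_smul_dirac_singleton, succ_mul_mixedPoi_succ, mean_mixedPoi]
    _ = ∫⁻ x, ENNReal.ofReal x / (∫⁻ y, ENNReal.ofReal y ∂μ) * poi x {k} ∂μ := by
        rw [div_eq_mul_inv, ← lintegral_mul_const _ (by fun_prop)]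
        exact lintegral_congr fun x => by rw [div_eq_mul_inv, mul_right_comm]
    _ = mixedPoi (sizeBiasReal μ) {k} := by
        rw [mixedPoi_singleton, sizeBiasReal, lintegral_withDensity_eq_lintegral_mul _ hden hpoi]
        rfl

variable {μ}

lemma integral_sizeBiasReal (hμ : ∀ᵐ x ∂μ, 0 ≤ x) (f : ℝ → ℝ) :
    ∫ x, f x ∂(sizeBiasReal μ) = (∫ x, x * f x ∂μ) / ∫ x, x ∂μ := by
  have hmean : (∫⁻ x, ENNReal.ofReal x ∂μ).toReal = ∫ x, x ∂μ :=
    (integral_eq_lintegral_of_nonneg_ae hμ aestronglyMeasurable_id).symm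
  have hfin : ∀ᵐ x ∂μ, ENNReal.ofReal x / ∫⁻ y, ENNReal.ofReal y ∂μ < ∞ := by
    rcases eq_or_ne (∫⁻ y, ENNReal.ofReal y ∂μ) 0 with hzero | hne
    · filter_upwards [(lintegral_eq_zero_iff ENNReal.measurable_ofReal).1 hzero] with x hx
      simp [show ENNReal.ofReal x = 0 from hx]
    · exact .of_forall fun x => ENNReal.div_lt_top ENNReal.ofReal_ne_top hne
  rw [sizeBiasReal, integral_withDensity_eq_integral_toReal_smul (by fun_prop) hfin,
    ← integral_div]
  refine integral_congr_ae (hμ.mono fun x hx => ?_)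
  simp only [ENNReal.toReal_div, ENNReal.toReal_ofReal hx, hmean, smul_eq_mul]
  ring

section GenFunMixedPoi

variable {s : ℝ}

lemma genFun_mixedPoi_eq_integral_genFun_poi [IsFiniteMeasure μ] (hs : s ∈ Icc (0 : ℝ) 1) :
    genFun (mixedPoi μ) s = ∫ x, genFun (poi x) s ∂μ := by
  have hmeas (k : ℕ) : Measurable fun x : ℝ => (poi x).real {k} :=
    (measurable_poi_singleton k).ennreal_toReal
  have hmass (k : ℕ) : (mixedPoi μ).real {k} = ∫ x, (poi x).real {k} ∂μ := by
    rw [measureReal_def, mixedPoi_singleton]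
    exact (integral_toReal (measurable_poi_singleton k).aemeasurable
      (.of_forall fun x => measure_lt_top _ _)).symm
  have hint (k : ℕ) : Integrable (fun x : ℝ => s ^ k * (poi x).real {k}) μ :=
    (Integrable.of_bound (hmeas k).aestronglyMeasurable 1 (.of_forall fun x => by
      rw [Real.norm_of_nonneg measureReal_nonneg]; exact measureReal_le_one)).const_mul _
  have hterm (k : ℕ) : s ^ k * (mixedPoi μ).real {k} = ∫ x, s ^ k * (poi x).real {k} ∂μ := by
    rw [hmass, integral_const_mul]
  have hnorm (k : ℕ) (x : ℝ) : ‖s ^ k * (poi x).real {k}‖ = s ^ k * (poi x).real {k} :=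
    Real.norm_of_nonneg (mul_nonneg (pow_nonneg hs.1 k) measureReal_nonneg)
  simp only [genFun, hterm]
  refine integral_tsum_of_summable_integral_norm hint ?_
  simpa only [hnorm, hterm] using summable_pow_mul_measureReal_singleton (p := mixedPoi μ) hs

lemma genFun_mixedPoi [IsFiniteMeasure μ] (hμ : ∀ᵐ x ∂μ, 0 ≤ x) (hs : s ∈ Icc (0 : ℝ) 1) :
    genFun (mixedPoi μ) s = ∫ x, Real.exp (-(x * (1 - s))) ∂μ := by
  rw [genFun_mixedPoi_eq_integral_genFun_poi hs]
  exact integral_congr_ae (hμ.mono fun x hx => genFun_poi hx s)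

lemma ae_sizeBiasReal {P : ℝ → Prop} (h : ∀ᵐ x ∂μ, P x) : ∀ᵐ x ∂(sizeBiasReal μ), P x :=
  (withDensity_absolutelyContinuous _ _).ae_le h

lemma genFun_mixedPoi_sizeBiasReal (hμ : ∀ᵐ x ∂μ, 0 ≤ x) (hs : s ∈ Icc (0 : ℝ) 1) :
    genFun (mixedPoi (sizeBiasReal μ)) s =
      (∫ x, x * Real.exp (-(x * (1 - s))) ∂μ) / ∫ x, x ∂μ := by
  rw [genFun_mixedPoi (ae_sizeBiasReal hμ) hs, integral_sizeBiasReal hμ]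

lemma integrable_exp_neg_mul [IsFiniteMeasure μ] (hμ : ∀ᵐ x ∂μ, 0 ≤ x) {u : ℝ} (hu : 0 ≤ u) :
    Integrable (fun x => Real.exp (-(x * u))) μ :=
  .of_bound (by fun_prop) 1 (hμ.mono fun x hx => by
    rw [Real.norm_of_nonneg (Real.exp_pos _).le, Real.exp_le_one_iff]
    exact neg_nonpos.2 (mul_nonneg hx hu))

lemma integrable_mul_exp_neg_mul (hμ : ∀ᵐ x ∂μ, 0 ≤ x) (hint : Integrable (fun x => x) μ) {u : ℝ}
    (hu : 0 ≤ u) : Integrable (fun x => x * Real.exp (-(x * u))) μ :=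
  hint.mul_bdd (by fun_prop) (hμ.mono fun x hx => by
    rw [Real.norm_of_nonneg (Real.exp_pos _).le, Real.exp_le_one_iff]
    exact neg_nonpos.2 (mul_nonneg hx hu))

lemma genFun_mixedPoi_one_sub_div_le (hμ1 : μ univ ≤ 1) {c y : ℝ}
    (hμ : ∀ᵐ x ∂μ, c ≤ x) (hy : 0 < y) (hc : y / (1 - Real.exp (-y)) ≤ c) :
    genFun (mixedPoi μ) (1 - y / c) ≤ 1 - y / c := by
  have : IsFiniteMeasure μ := ⟨hμ1.trans_lt ENNReal.one_lt_top⟩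
  have hc0 : 0 < c := (div_one_sub_exp_neg_pos hy).trans_le hc
  have hle := exp_neg_le_one_sub_div hy hc
  have hμ0 : ∀ᵐ x ∂μ, 0 ≤ x := hμ.mono fun _ => hc0.le.trans
  have hs : 1 - y / c ∈ Icc (0 : ℝ) 1 :=
    ⟨(Real.exp_pos _).le.trans hle, sub_le_self 1 (div_pos hy hc0).le⟩
  calc genFun (mixedPoi μ) (1 - y / c) = ∫ x, Real.exp (-(x * (y / c))) ∂μ := by
        rw [genFun_mixedPoi hμ0 hs, sub_sub_cancel]
    _ ≤ ∫ _, Real.exp (-y) ∂μ := by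
        refine integral_mono_ae (integrable_exp_neg_mul hμ0 (div_pos hy hc0).le)
          (integrable_const _) (hμ.mono fun x hx => ?_)
        rw [Real.exp_le_exp, neg_le_neg_iff, ← mul_div_assoc, le_div_iff₀ hc0, mul_comm]
        gcongr
    _ ≤ Real.exp (-y) := by
        rw [integral_const, smul_eq_mul]
        exact mul_le_of_le_one_left (Real.exp_pos _).le
          (ENNReal.toReal_le_of_le_ofReal zero_le_one (by simpa using hμ1))
    _ ≤ 1 - y / c := hle

end GenFunMixedPoi

end MixedPoisson

/-! ### Convex order -/

section ConvexOrder

/-- The convex order `μ ≤ ν` relative to `S`, tested only on functions that are convex on `S`. It is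
meant for measures concentrated on `S`, and both integrals are required to exist. -/
def ConvexOrderOn (S : Set ℝ) (μ ν : Measure ℝ) : Prop :=
  ∀ f : ℝ → ℝ, ConvexOn ℝ S f → Integrable f μ → Integrable f ν → ∫ x, f x ∂μ ≤ ∫ x, f x ∂ν

variable {S : Set ℝ} {μ ν : Measure ℝ}

lemma ConvexOrderOn.integral_id_eq (h : ConvexOrderOn S μ ν) (hS : Convex ℝ S)
    (hμ : Integrable (fun x => x) μ) (hν : Integrable (fun x => x) ν) :
    ∫ x, x ∂μ = ∫ x, x ∂ν := by
  refine (h _ (convexOn_id hS) hμ hν).antisymm ?_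
  have hneg : ∫ x, -x ∂μ ≤ ∫ x, -x ∂ν := h _ (concaveOn_id hS).neg hμ.neg hν.neg
  rwa [integral_neg, integral_neg, neg_le_neg_iff] at hneg

lemma exists_forall_add_mul_sub_le_of_mem_uIcc {f : ℝ → ℝ} (hf : ConvexOn ℝ S f) {x₀ : ℝ}
    (hx₀ : x₀ ∈ interior S) :
    ∃ k : ℝ, ∀ y ∈ S, ∀ x ∈ uIcc x₀ y, f x + k * (y - x) ≤ f y := by
  -- `f` minus its supporting line at `x₀` is minimal at `x₀`, hence monotone away from `x₀`.
  set k := derivWithin f (Ioi x₀) x₀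
  have hg : ConvexOn ℝ S fun x => f x - k * x :=
    hf.sub ((LinearMap.mulLeft ℝ k).concaveOn hf.1)
  have hderiv : derivWithin (fun x => f x - k * x) (Ioi x₀) x₀ = 0 := by
    have hg' := (hf.hasDerivWithinAt_rightDeriv_of_mem_interior hx₀).sub
      ((hasDerivWithinAt_id x₀ (Ioi x₀)).const_mul k)
    rw [mul_one, sub_self] at hg'
    exact hg'.derivWithin (uniqueDiffWithinAt_Ioi x₀)
  have hmin := hg.isMinOn_of_rightDeriv_eq_zero hx₀ hderiv
  refine ⟨k, fun y hy x hx => ?_⟩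
  have hle := hg.le_max_of_mem_segment (interior_subset hx₀) hy (segment_eq_uIcc x₀ y ▸ hx)
  rw [max_eq_right (hmin hy)] at hle
  linarith

variable {Ω : Type*} [MeasurableSpace Ω] {P : Measure Ω}

lemma convexOrderOn_map_of_mem_uIcc {X Y : Ω → ℝ} (hX : Integrable X P) (hY : Integrable Y P)
    (hmean : ∫ ω, X ω ∂P = ∫ ω, Y ω ∂P) {x₀ : ℝ} (hx₀ : x₀ ∈ interior S)
    (hYS : ∀ᵐ ω ∂P, Y ω ∈ S) (hXY : ∀ᵐ ω ∂P, X ω ∈ uIcc x₀ (Y ω)) :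
    ConvexOrderOn S (P.map X) (P.map Y) := by
  intro f hf hfX hfY
  obtain ⟨k, hk⟩ := exists_forall_add_mul_sub_le_of_mem_uIcc hf hx₀
  have hfX' : Integrable (fun ω => f (X ω)) P := hfX.comp_aemeasurable hX.aemeasurable
  have hfY' : Integrable (fun ω => f (Y ω)) P := hfY.comp_aemeasurable hY.aemeasurable
  have hYX : Integrable (fun ω => k * (Y ω - X ω)) P := (hY.sub hX).const_mul k
  rw [integral_map hX.aemeasurable hfX.1, integral_map hY.aemeasurable hfY.1]
  calc ∫ ω, f (X ω) ∂P = ∫ ω, f (X ω) + k * (Y ω - X ω) ∂P := by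
        rw [integral_add hfX' hYX, integral_const_mul, integral_sub hY hX,
          hmean, sub_self, mul_zero, add_zero]
    _ ≤ ∫ ω, f (Y ω) ∂P := by
        refine integral_mono_ae (hfX'.add hYX) hfY' ?_
        filter_upwards [hYS, hXY] with ω hω hω'
        exact hk _ hω _ hω'

lemma convexOrderOn_dirac_integral [IsProbabilityMeasure ν] (hν : Integrable (fun x => x) ν)
    (hνS : ∀ᵐ x ∂ν, x ∈ S) (hmean : ∫ x, x ∂ν ∈ interior S) :
    ConvexOrderOn S (Measure.dirac (∫ x, x ∂ν)) ν := by
  simpa using convexOrderOn_map_of_mem_uIcc (X := fun _ => ∫ x, x ∂ν) (Y := fun x => x)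
    (integrable_const _) hν (by simp) hmean hνS (.of_forall fun _ => left_mem_uIcc)

lemma convexOn_exp_neg_mul (u : ℝ) (hS : Convex ℝ S) :
    ConvexOn ℝ S fun x => Real.exp (-(x * u)) := by
  have hexp := convexOn_exp.comp_linearMap (LinearMap.mulRight ℝ (-u))
  simpa [Function.comp_def] using hexp.subset (subset_univ S) hS

lemma convexOn_mul_exp_neg_mul {c u : ℝ} (hu : 0 ≤ u) (hcu : 2 ≤ c * u) :
    ConvexOn ℝ (Ici c) fun x => x * Real.exp (-(x * u)) := by
  have hexp (x : ℝ) : HasDerivAt (fun x => Real.exp (-(x * u))) (Real.exp (-(x * u)) * -u) x := by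
    simpa using ((hasDerivAt_id x).mul_const u).neg.exp
  have hderiv (x : ℝ) : HasDerivAt (fun x => x * Real.exp (-(x * u)))
      ((1 - x * u) * Real.exp (-(x * u))) x :=
    ((hasDerivAt_id x).mul (hexp x)).congr_deriv (by simp only [id_eq]; ring)
  have hderiv2 (x : ℝ) : HasDerivAt (fun x => (1 - x * u) * Real.exp (-(x * u)))
      (u * (x * u - 2) * Real.exp (-(x * u))) x :=
    ((((hasDerivAt_id x).mul_const u).const_sub 1).mul (hexp x)).congr_deriv (by
      simp only [id_eq]; ring)
  refine convexOn_of_hasDerivWithinAt2_nonneg (convex_Ici c) (by fun_prop)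
    (fun x _ => (hderiv x).hasDerivWithinAt) (fun x _ => (hderiv2 x).hasDerivWithinAt)
    fun x hx => ?_
  have hxu : 2 ≤ x * u := hcu.trans (mul_le_mul_of_nonneg_right (interior_subset hx) hu)
  exact mul_nonneg (mul_nonneg hu (sub_nonneg.2 hxu)) (Real.exp_pos _).le

end ConvexOrder

/-! ### Comparison of mixed Poisson distributions -/

section Comparison

variable {μ ν : Measure ℝ}

lemma genFun_mixedPoi_le_of_convexOrderOn {S : Set ℝ} [IsFiniteMeasure μ] [IsFiniteMeasure ν]
    (h : ConvexOrderOn S μ ν) (hS : Convex ℝ S) (hμ : ∀ᵐ x ∂μ, 0 ≤ x) (hν : ∀ᵐ x ∂ν, 0 ≤ x)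
    {s : ℝ} (hs : s ∈ Icc (0 : ℝ) 1) : genFun (mixedPoi μ) s ≤ genFun (mixedPoi ν) s := by
  have hu : 0 ≤ 1 - s := sub_nonneg.2 hs.2
  rw [genFun_mixedPoi hμ hs, genFun_mixedPoi hν hs]
  exact h _ (convexOn_exp_neg_mul _ hS) (integrable_exp_neg_mul hμ hu)
    (integrable_exp_neg_mul hν hu)

lemma genFun_mixedPoi_sizeBiasReal_le_of_convexOrderOn {c : ℝ} (h : ConvexOrderOn (Ici c) μ ν)
    (hμ : ∀ᵐ x ∂μ, 0 ≤ x) (hν : ∀ᵐ x ∂ν, 0 ≤ x) (hμint : Integrable (fun x => x) μ)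
    (hνint : Integrable (fun x => x) ν) {s : ℝ} (hs : s ∈ Icc (0 : ℝ) 1)
    (hcs : 2 ≤ c * (1 - s)) :
    genFun (mixedPoi (sizeBiasReal μ)) s ≤ genFun (mixedPoi (sizeBiasReal ν)) s := by
  have hu : 0 ≤ 1 - s := sub_nonneg.2 hs.2
  rw [genFun_mixedPoi_sizeBiasReal hμ hs, genFun_mixedPoi_sizeBiasReal hν hs,
    h.integral_id_eq (convex_Ici c) hμint hνint]
  exact div_le_div_of_nonneg_right (h _ (convexOn_mul_exp_neg_mul hu hcs)
    (integrable_mul_exp_neg_mul hμ hμint hu) (integrable_mul_exp_neg_mul hν hνint hu))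
    (integral_nonneg_of_ae hν)

lemma zetaCM_mixedPoi_le_of_convexOrderOn [IsFiniteMeasure μ] [IsFiniteMeasure ν] {c : ℝ}
    (h : ConvexOrderOn (Ici c) μ ν) (hc : lambdaCr ≤ c)
    (hμ : ∀ᵐ x ∂μ, c ≤ x) (hν : ∀ᵐ x ∂ν, c ≤ x) (hμint : Integrable (fun x => x) μ)
    (hνint : Integrable (fun x => x) ν) : zetaCM (mixedPoi ν) ≤ zetaCM (mixedPoi μ) := by
  have hc0 : 0 < c := lambdaCr_pos.trans_le hc
  rw [lambdaCr_eq] at hc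
  have hs : 1 - 2 / c ∈ Icc (0 : ℝ) 1 :=
    ⟨(Real.exp_pos _).le.trans (exp_neg_le_one_sub_div two_pos hc), sub_le_self 1 (by positivity)⟩
  have hμ0 : ∀ᵐ x ∂μ, 0 ≤ x := hμ.mono fun _ => hc0.le.trans
  have hν0 : ∀ᵐ x ∂ν, 0 ≤ x := hν.mono fun _ => hc0.le.trans
  rw [zetaCM, zetaCM, downshiftedSizeBias_mixedPoi, downshiftedSizeBias_mixedPoi]
  have hνle := genFun_mixedPoi_one_sub_div_le (sizeBiasReal_univ_le_one ν) (ae_sizeBiasReal hν)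
    two_pos hc
  have hην := extinctionProb_mem_Icc_of_genFun_le hs hνle
  have hfix := genFun_extinctionProb_of_genFun_le hs hνle
  set η := extinctionProb (mixedPoi (sizeBiasReal ν))
  have hη1 : η ∈ Icc (0 : ℝ) 1 := ⟨hην.1, hην.2.trans hs.2⟩
  have hcη : 2 ≤ c * (1 - η) := by
    rw [← div_le_iff₀' hc0]
    linarith [hην.2]
  have hημ := extinctionProb_mem_Icc_of_genFun_le hη1
    ((genFun_mixedPoi_sizeBiasReal_le_of_convexOrderOn h hμ0 hν0 hμint hνint hη1 hcη).trans_eq hfix)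
  refine sub_le_sub_left ?_ 1
  exact (monotoneOn_genFun ⟨hημ.1, hημ.2.trans hη1.2⟩ hη1 hημ.2).trans
    (genFun_mixedPoi_le_of_convexOrderOn h (convex_Ici c) hμ0 hν0 hη1)

end Comparison

/-! ### Pareto distributions -/

section Pareto

variable {t r : ℝ}

lemma paretoMeasure_eq_withDensity_restrict (t r : ℝ) :
    paretoMeasure t r = (volume.restrict (Ioi t)).withDensity
      fun x => ENNReal.ofReal (r * t ^ r * x ^ (-(r + 1))) := by
  rw [paretoMeasure, Measure.restrict_congr_set Ioi_ae_eq_Ici,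
    ← withDensity_indicator measurableSet_Ici]
  congr 1 with x
  rw [paretoPDF_eq, indicator_apply]
  simp only [mem_Ici, apply_ite ENNReal.ofReal, ENNReal.ofReal_zero]

lemma ae_le_paretoMeasure (t r : ℝ) : ∀ᵐ x ∂(paretoMeasure t r), t ≤ x := by
  rw [paretoMeasure_eq_withDensity_restrict]
  exact (withDensity_absolutelyContinuous _ _).ae_le
    ((ae_restrict_mem measurableSet_Ioi).mono fun _ hx => hx.le)

lemma measureReal_paretoMeasure_Ioi (ht : 0 < t) (hr : 0 < r) {x : ℝ} (hx : t ≤ x) :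
    (paretoMeasure t r).real (Ioi x) = (t / x) ^ r := by
  have hx0 : 0 < x := ht.trans_le hx
  have hlt : -(r + 1) < -1 := by linarith
  have hint := (integrableOn_Ioi_rpow_of_lt hlt hx0).const_mul (r * t ^ r)
  have hnonneg : 0 ≤ᵐ[volume.restrict (Ioi x)] fun y => r * t ^ r * y ^ (-(r + 1)) := by
    filter_upwards [ae_restrict_mem measurableSet_Ioi] with y hy
    have hy0 : 0 < y := hx0.trans hy
    positivity
  rw [paretoMeasure_eq_withDensity_restrict, measureReal_def, withDensity_apply _ measurableSet_Ioi,
    Measure.restrict_restrict_of_subset (Ioi_subset_Ioi hx),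
    ← integral_eq_lintegral_of_nonneg_ae hnonneg hint.1, integral_const_mul,
    integral_Ioi_rpow_of_lt hlt hx0, neg_add_rev, neg_add_cancel_comm,
    Real.rpow_neg hx0.le, Real.div_rpow ht.le hx0.le]
  field_simp

lemma cdf_paretoMeasure (ht : 0 < t) (hr : 0 < r) (x : ℝ) :
    cdf (paretoMeasure t r) x = if t ≤ x then 1 - (t / x) ^ r else 0 := by
  have := isProbabilityMeasure_paretoMeasure ht hr
  rw [cdf_eq_real]
  split_ifs with hx
  · rw [← measureReal_paretoMeasure_Ioi ht hr hx, ← compl_Ioi, probReal_compl_eq_one_sub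
      measurableSet_Ioi]
  · rw [measureReal_eq_zero_iff]
    exact measure_mono_null (fun y hy => (hy.trans_lt (not_le.1 hx)).not_ge)
      (ae_iff.1 (ae_le_paretoMeasure t r))

lemma map_mul_exp_div_expMeasure_one (ht : 0 < t) (hr : 0 < r) :
    (expMeasure 1).map (fun y => t * Real.exp (y / r)) = paretoMeasure t r := by
  have := isProbabilityMeasure_expMeasure one_pos
  have := isProbabilityMeasure_paretoMeasure ht hr
  have hmeas : Measurable fun y : ℝ => t * Real.exp (y / r) := by fun_prop
  have := Measure.isProbabilityMeasure_map (μ := expMeasure 1) hmeas.aemeasurable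
  refine Measure.eq_of_cdf _ _ (StieltjesFunction.ext fun x => ?_)
  rw [cdf_paretoMeasure ht hr, cdf_eq_real, map_measureReal_apply hmeas measurableSet_Iic]
  rcases le_or_gt x 0 with hx | hx
  · have hempty : (fun y : ℝ => t * Real.exp (y / r)) ⁻¹' Iic x = ∅ :=
      eq_empty_of_forall_notMem fun y hy => (hx.trans_lt (by positivity)).not_ge hy
    rw [hempty, measureReal_empty, if_neg (hx.trans_lt ht).not_ge]
  · have hpre : (fun y : ℝ => t * Real.exp (y / r)) ⁻¹' Iic x = Iic (r * Real.log (x / t)) := by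
      ext y
      rw [mem_preimage, mem_Iic, mem_Iic, ← le_div_iff₀' ht,
        ← Real.le_log_iff_exp_le (by positivity), div_le_iff₀' hr]
    have hlog : 0 ≤ r * Real.log (x / t) ↔ t ≤ x := by
      rw [mul_nonneg_iff_of_pos_left hr, Real.log_nonneg_iff (by positivity), one_le_div ht]
    rw [hpre, ← cdf_eq_real, cdf_expMeasure_eq one_pos]
    simp only [hlog, one_mul]
    rw [mul_comm, ← neg_mul, ← Real.log_inv, inv_div, ← Real.rpow_def_of_pos (by positivity)]

lemma toReal_ofReal_mul_rpow_ae_eq (ht : 0 < t) (hr : 0 ≤ r) :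
    (fun x => (ENNReal.ofReal (r * t ^ r * x ^ (-(r + 1)))).toReal * x)
      =ᵐ[volume.restrict (Ioi t)] fun x => r * t ^ r * x ^ (-r) := by
  filter_upwards [ae_restrict_mem measurableSet_Ioi] with x hx
  have hx0 : 0 < x := ht.trans hx
  rw [ENNReal.toReal_ofReal (by positivity), mul_assoc, ← Real.rpow_add_one hx0.ne',
    neg_add, neg_add_cancel_right]

lemma integrable_id_paretoMeasure (ht : 0 < t) (hr : 1 < r) :
    Integrable (fun x => x) (paretoMeasure t r) := by
  rw [paretoMeasure_eq_withDensity_restrict,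
    integrable_withDensity_iff_integrable_smul' (by fun_prop)
      (.of_forall fun _ => ENNReal.ofReal_lt_top)]
  exact ((integrableOn_Ioi_rpow_of_lt (neg_lt_neg hr) ht).const_mul _).congr
    (toReal_ofReal_mul_rpow_ae_eq ht (by linarith)).symm

lemma integral_id_paretoMeasure (ht : 0 < t) (hr : 1 < r) :
    ∫ x, x ∂(paretoMeasure t r) = r * t / (r - 1) := by
  have hr1 : 0 < r - 1 := sub_pos.2 hr
  rw [paretoMeasure_eq_withDensity_restrict,
    integral_withDensity_eq_integral_toReal_smul (by fun_prop)
      (.of_forall fun _ => ENNReal.ofReal_lt_top)]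
  simp only [smul_eq_mul]
  rw [integral_congr_ae (toReal_ofReal_mul_rpow_ae_eq ht (by linarith)), integral_const_mul,
    integral_Ioi_rpow_of_lt (neg_lt_neg hr) ht, neg_add_eq_sub, ← neg_sub r 1, neg_div_neg_eq,
    Real.rpow_neg ht.le, Real.rpow_sub_one ht.ne']
  field_simp

lemma exp_div_mem_uIcc_one_exp_div {p q : ℝ} (hp : 0 < p) (hpq : p ≤ q) (y : ℝ) :
    Real.exp (y / q) ∈ uIcc 1 (Real.exp (y / p)) := by
  refine mem_uIcc.2 ((le_total 0 y).imp (fun hy => ⟨?_, ?_⟩) fun hy => ⟨?_, ?_⟩)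
  · exact Real.one_le_exp (div_nonneg hy (hp.le.trans hpq))
  · exact Real.exp_le_exp.2 (div_le_div_of_nonneg_left hy hp hpq)
  · rw [Real.exp_le_exp, div_eq_mul_inv, div_eq_mul_inv]
    exact mul_le_mul_of_nonpos_left (inv_anti₀ hp hpq) hy
  · exact Real.exp_le_one_iff.2 (div_nonpos_of_nonpos_of_nonneg hy (hp.le.trans hpq))

lemma exists_forall_mul_exp_div_mem_uIcc {a b p q : ℝ} (ha : 0 < a) (hab : a < b) (hp : 0 < p)
    (hpq : p < q) :
    ∃ x₀, a < x₀ ∧ ∀ y, b * Real.exp (y / q) ∈ uIcc x₀ (a * Real.exp (y / p)) := by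
  have hlog : 0 < Real.log (b / a) := Real.log_pos ((one_lt_div ha).2 hab)
  have hinv : 0 < 1 / p - 1 / q := sub_pos.2 (one_div_lt_one_div_of_lt hp hpq)
  set y₀ := Real.log (b / a) / (1 / p - 1 / q)
  have hcross : y₀ / p = Real.log (b / a) + y₀ / q := by
    linear_combination div_mul_cancel₀ (Real.log (b / a)) hinv.ne'
  have hx₀ : a * Real.exp (y₀ / p) = b * Real.exp (y₀ / q) := by
    rw [hcross, Real.exp_add, Real.exp_log (div_pos (ha.trans hab) ha)]
    field_simp
  refine ⟨a * Real.exp (y₀ / p), ?_, fun y => ?_⟩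
  · exact lt_mul_of_one_lt_right ha (Real.one_lt_exp_iff.2 (by positivity))
  · have hp' : a * Real.exp (y / p) = a * Real.exp (y₀ / p) * Real.exp ((y - y₀) / p) := by
      rw [mul_assoc, ← Real.exp_add, ← add_div, add_sub_cancel]
    have hq' : b * Real.exp (y / q) = a * Real.exp (y₀ / p) * Real.exp ((y - y₀) / q) := by
      rw [hx₀, mul_assoc, ← Real.exp_add, ← add_div, add_sub_cancel]
    have hmono : Monotone (a * Real.exp (y₀ / p) * ·) := monotone_mul_left_of_nonneg (by positivity)
    simpa only [hp', hq', mul_one] using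
      hmono.mapsTo_uIcc (exp_div_mem_uIcc_one_exp_div hp hpq.le (y - y₀))

lemma convexOrderOn_paretoMeasure {a b p q : ℝ} (ha : 0 < a) (hab : a < b) (hp : 1 < p)
    (hpq : p < q) (hmean : ∫ x, x ∂(paretoMeasure b q) = ∫ x, x ∂(paretoMeasure a p)) :
    ConvexOrderOn (Ici a) (paretoMeasure b q) (paretoMeasure a p) := by
  have hp0 : 0 < p := one_pos.trans hp
  have hX := integrable_id_paretoMeasure (ha.trans hab) (hp.trans hpq)
  have hY := integrable_id_paretoMeasure ha hp
  have hYa := ae_le_paretoMeasure a p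
  have hXmeas : Measurable fun y : ℝ => b * Real.exp (y / q) := by fun_prop
  have hYmeas : Measurable fun y : ℝ => a * Real.exp (y / p) := by fun_prop
  obtain ⟨x₀, hx₀, hcross⟩ := exists_forall_mul_exp_div_mem_uIcc ha hab hp0 hpq
  simp only [← map_mul_exp_div_expMeasure_one ha hp0,
    ← map_mul_exp_div_expMeasure_one (ha.trans hab) (hp0.trans hpq)] at hX hY hYa hmean ⊢
  rw [integral_map hXmeas.aemeasurable hX.1, integral_map hYmeas.aemeasurable hY.1] at hmean
  exact convexOrderOn_map_of_mem_uIcc (hX.comp_measurable hXmeas) (hY.comp_measurable hYmeas) hmean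
    (interior_Ici (a := a) ▸ hx₀) (ae_of_ae_map hYmeas.aemeasurable hYa) (.of_forall hcross)

end Pareto

section ParetoMixedPoi

variable {lam α : ℝ}

lemma integral_id_paretoMeasure_mul_one_sub_one_div (hlam : 0 < lam) (hα : 1 < α) :
    ∫ x, x ∂(paretoMeasure (lam * (1 - 1 / α)) α) = lam := by
  have hα1 : 0 < 1 - 1 / α := sub_pos.2 ((div_lt_one (one_pos.trans hα)).2 hα)
  have hα' : α - 1 ≠ 0 := (sub_pos.2 hα).ne'
  rw [integral_id_paretoMeasure (mul_pos hlam hα1) hα]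
  field_simp

lemma zetaCM_paretoMixedPoi_mono {β : ℝ} (hα : 1 < α) (hαβ : α ≤ β)
    (hc : lambdaCr ≤ lam * (1 - 1 / α)) :
    zetaCM (paretoMixedPoi lam α) ≤ zetaCM (paretoMixedPoi lam β) := by
  rcases hαβ.eq_or_lt with rfl | hlt
  · exact le_rfl
  have hc0 : 0 < lam * (1 - 1 / α) := lambdaCr_pos.trans_le hc
  have hα0 : 0 < α := one_pos.trans hα
  have hβ : 1 < β := hα.trans hlt
  have hlam : 0 < lam := pos_of_mul_pos_left hc0 (sub_pos.2 ((div_lt_one hα0).2 hα)).le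
  have hcc : lam * (1 - 1 / α) < lam * (1 - 1 / β) :=
    mul_lt_mul_of_pos_left (sub_lt_sub_left (one_div_lt_one_div_of_lt hα0 hlt) 1) hlam
  have := isProbabilityMeasure_paretoMeasure hc0 hα0
  have := isProbabilityMeasure_paretoMeasure (hc0.trans hcc) (hα0.trans hlt)
  refine zetaCM_mixedPoi_le_of_convexOrderOn ?_ hc
    ((ae_le_paretoMeasure _ β).mono fun _ => hcc.le.trans) (ae_le_paretoMeasure _ α)
    (integrable_id_paretoMeasure (hc0.trans hcc) hβ) (integrable_id_paretoMeasure hc0 hα)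
  refine convexOrderOn_paretoMeasure hc0 hcc hα hlt ?_
  rw [integral_id_paretoMeasure_mul_one_sub_one_div hlam hα,
    integral_id_paretoMeasure_mul_one_sub_one_div hlam hβ]

lemma zetaCM_paretoMixedPoi_le_zetaCM_poi (hα : 1 < α)
    (hc : lambdaCr ≤ lam * (1 - 1 / α)) :
    zetaCM (paretoMixedPoi lam α) ≤ zetaCM (poi lam) := by
  have hc0 : 0 < lam * (1 - 1 / α) := lambdaCr_pos.trans_le hc
  have hα0 : 0 < α := one_pos.trans hα
  have hlam : 0 < lam := pos_of_mul_pos_left hc0 (sub_pos.2 ((div_lt_one hα0).2 hα)).le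
  have hclam : lam * (1 - 1 / α) < lam :=
    mul_lt_of_lt_one_right hlam (sub_lt_self 1 (one_div_pos.2 hα0))
  have := isProbabilityMeasure_paretoMeasure hc0 hα0
  have hmean := integral_id_paretoMeasure_mul_one_sub_one_div hlam hα
  have hint := integrable_id_paretoMeasure hc0 hα
  have hge := ae_le_paretoMeasure (lam * (1 - 1 / α)) α
  have horder := convexOrderOn_dirac_integral hint hge (S := Ici (lam * (1 - 1 / α)))
    (by rwa [interior_Ici, hmean])
  rw [hmean] at horder
  rw [← mixedPoi_dirac]
  exact zetaCM_mixedPoi_le_of_convexOrderOn horder hc ((ae_dirac_iff measurableSet_Ici).2 hclam.le)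
    hge (integrable_dirac (by simp)) hint

end ParetoMixedPoi

end BranchingCM

theorem mainTheorem2 (lam : ℝ) (hlam : BranchingCM.lambdaCr < lam) :
    ∃ αcr : ℝ, 1 < αcr ∧ ∀ α β : ℝ, αcr ≤ α → α ≤ β →
      BranchingCM.zetaCM (BranchingCM.paretoMixedPoi lam α) ≤
          BranchingCM.zetaCM (BranchingCM.paretoMixedPoi lam β) ∧
        BranchingCM.zetaCM (BranchingCM.paretoMixedPoi lam β) ≤
          BranchingCM.zetaCM (BranchingCM.poi lam) := by
  have hscale : Filter.Tendsto (fun α : ℝ => lam * (1 - 1 / α)) Filter.atTop (nhds lam) := by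
    simpa using (tendsto_inv_atTop_zero.const_sub 1).const_mul lam
  obtain ⟨αcr, hαcr⟩ := Filter.eventually_atTop.1
    ((Filter.eventually_gt_atTop 1).and (hscale.eventually_const_le hlam))
  refine ⟨αcr, (hαcr αcr le_rfl).1, fun α β hα hαβ => ?_⟩
  obtain ⟨hα1, hcα⟩ := hαcr α hα
  obtain ⟨hβ1, hcβ⟩ := hαcr β (hα.trans hαβ)
  exact ⟨BranchingCM.zetaCM_paretoMixedPoi_mono hα1 hαβ hcα,
    BranchingCM.zetaCM_paretoMixedPoi_le_zetaCM_poi hβ1 hcβ⟩
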